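/- Notation. For integers $n\ge 0$, $s\ge 1$ let $H_n^{(s)}=\sum_{j=1}^n j^{-s}$ and $H_n=H_n^{(1)}$. For real $a>-1$ let $H_n^{(s)}(a)=\sum_{j=1}^n (j+a)^{-s}$ (parametric harmonic numbers; empty sums are $0$). Let $\psi=\Gamma'/\Gamma$ be the digamma function, $\psi^{(m)}$ its $m$-th derivative, and for real $\alpha>-1$ and integers $m\ge1$ let $$H_\alpha^{(m)}=\frac{(-1)^{m-1}}{(m-1)!}\left(\psi^{(m-1)}(\alpha+1)-\psi^{(m-1)}(1)\right),\qquad H_\alpha=H_\alpha^{(1)}$$ (shifted harmonic numbers; they agree with $H_n^{(m)}$ when $\alpha=n$, and $H_\alpha=\psi(\alpha+1)+\gamma$ with $\gamma$ the Euler–Mascheroni constant). Let $\zeta$ be the Riemann zeta function. Theorem 2.6. Let $k\ge 1$ be an integer and $a>0$ a real number. Then the series below converge and $$\sum_{n=1}^\infty\frac{H_nH_n^{(2)}}{(n+a)(n+a+k)}=\frac1k\left\{\sum_{i=0}^{k-1}\frac1{a+i}\sum_{n=1}^\infty\frac{H_{n+a+i}}{n^2}-\sum_{i=0}^{k-1}\frac{H_{a+i}^2+H_{a+i}^{(2)}}{2(a+i)^2}-\zeta(2)H_k^{(2)}(a-1)+\sum_{i=0}^{k-1}\frac{H_{a+i}}{(a+i)^3}\right\},\tag{2.28}$$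 $$\begin{aligned}\sum_{n=1}^\infty\frac{H_n^3}{(n+a)(n+a+k)}=\frac1k\Bigg\{&\sum_{i=1}^{k}\frac{H_{a+i-1}^3+3H_{a+i-1}H_{a+i-1}^{(2)}+2H_{a+i-1}^{(3)}}{a+i-1}+3\sum_{i=0}^{k-1}\frac1{a+i}\sum_{n=1}^\infty\frac{H_{n+a+i}}{n^2}\\&+3\sum_{i=1}^{k-1}\frac{H_{a+i}}{(a+i)^3}-\frac32\sum_{i=0}^{k-1}\frac{H_{a+i}^2+H_{a+i}^{(2)}}{(a+i)^2}-\zeta(2)H_{k-1}^{(2)}(a)\\&-2\sum_{i=1}^{k-1}\frac{H_i^{(1)}(a)}{(i+a)^3}-2\zeta(3)H_{k-1}^{(1)}(a)-2H_aH_{k-1}^{(3)}(a)-\frac{2\zeta(3)}{a}-\frac{\zeta(2)}{a^2}+\frac{H_a}{a^3}\Bigg\}.\end{aligned}\tag{2.29}$$ -/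

import Mathlib

/-- The polygamma function `ψ^(m)` on the reals: the `m`-th derivative of the digamma function
`ψ = Γ' / Γ`. -/
noncomputable def realPolygamma (m : ℕ) (x : ℝ) : ℝ :=
  iteratedDeriv m (logDeriv Real.Gamma) x

/-- The shifted harmonic number `H_α^(m)` of order `m ≥ 1`,
`(-1)^(m-1) / (m-1)! * (ψ^(m-1)(α+1) - ψ^(m-1)(1))`.
For `m = 1` this is `ψ(α+1) + γ`, because `ψ(1) = -γ`. -/
noncomputable def shiftedHarmonic (m : ℕ) (α : ℝ) : ℝ :=
  (-1) ^ (m - 1) / ((m - 1).factorial : ℝ) *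
    (realPolygamma (m - 1) (α + 1) - realPolygamma (m - 1) 1)

/-- The parametric harmonic number `H_n^(s)(a) = ∑_{j=1}^n 1 / (j+a)^s`. -/
noncomputable def parametricHarmonic (s n : ℕ) (a : ℝ) : ℝ :=
  ∑ j ∈ Finset.Icc 1 n, 1 / ((j : ℝ) + a) ^ s

/-- The harmonic number `H_n^(s) = ∑_{j=1}^n 1 / j^s` of order `s`. -/
noncomputable def harmonicOfOrder (s n : ℕ) : ℝ :=
  ∑ j ∈ Finset.Icc 1 n, 1 / (j : ℝ) ^ s

/-- The value `ζ(m)` of the Riemann zeta function at an integer `m ≥ 2`, as a real number. -/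
noncomputable def zetaValue (m : ℕ) : ℝ := (riemannZeta (m : ℂ)).re

/-- The linear sum `∑_{n ≥ 1} H_{n+α} / n^2`. -/
noncomputable def linearSum (α : ℝ) : ℝ :=
  ∑' n : ℕ+, shiftedHarmonic 1 ((n : ℝ) + α) / (n : ℝ) ^ 2

/-! Since k/((n+a)(n+a+k)) telescopes into unit gaps 1/(n+b) - 1/(n+b+1) with b = a+i, it suffices
to treat one gap. Abel summation moves the difference onto X_n = H_n H_n^(2) or H_n^3; the increment
of X_n is a polynomial in 1/n, H_n, H_n^(2), and partial fractions of its quotient by n+b leave sums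
of H_n, H_n^2 or H_n^(2) against 1/n - 1/(n+b), together with zeta values and Σ H_n/n^2. The last
sum cancels, so its value is never needed.

The sums F_j(a) = Σ H_n^j (1/n - 1/(n+a)), j = 1, 2, are evaluated without integrals. Abel summation
gives F_j(a+1) - F_j(a), the proposed closed form has the same unit increments, both sides are
monotone in a, and they agree at one point. As the increments tend to zero along the integers,
`eq_of_monotoneOn_of_increments` forces equality, as in the Bohr–Mollerup theorem. The same
principle yields the series for ψ. The sum of H_n^(2) needs one more Abel summation, against the
decreasing tail H_{n+a} - H_n. -/

open Filter Topology Set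

/-- Two monotone functions on `[0, ∞)` with the same unit increments, which tend to zero along the
integers, coincide as soon as they agree at `0`. -/
theorem eq_of_monotoneOn_of_increments {f g : ℝ → ℝ}
    (hf : MonotoneOn f (Ici 0)) (hg : MonotoneOn g (Ici 0))
    (hfg : ∀ x, 0 ≤ x → f (x + 1) - f x = g (x + 1) - g x)
    (hlim : Tendsto (fun n : ℕ => f ((n : ℝ) + 1) - f n) atTop (𝓝 0))
    (h0 : f 0 = g 0) {x : ℝ} (hx : 0 ≤ x) : f x = g x := by
  have hper : ∀ y, 0 ≤ y → ∀ n : ℕ, f (y + n) - g (y + n) = f y - g y := by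
    intro y hy n
    induction n with
    | zero => simp
    | succ n ih =>
      have := hfg (y + n) (by positivity)
      push_cast
      rw [← add_assoc]
      linarith
  have hnat : ∀ n : ℕ, f n = g n := by
    intro n
    have := hper 0 le_rfl n
    simp only [zero_add] at this
    linarith
  -- With N = n + ⌊x⌋, the point x+n lies in [N, N+1]. Both functions at x+n are therefore squeezed
  -- between the same two values, and f - g is unchanged by integer shifts.
  have hbound : ∀ n : ℕ, |f x - g x| ≤ f (((n + ⌊x⌋₊ : ℕ) : ℝ) + 1) - f ((n + ⌊x⌋₊ : ℕ) : ℝ) := by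
    intro n
    set N : ℕ := n + ⌊x⌋₊ with hN
    have h1 : (N : ℝ) ≤ x + n := by
      have := Nat.floor_le hx
      rw [hN]; push_cast; linarith
    have h2 : x + n ≤ (N : ℝ) + 1 := by
      have := (Nat.lt_floor_add_one x).le
      rw [hN]; push_cast; linarith
    have hN0 : (0 : ℝ) ≤ N := by positivity
    have e1 := hf (a := (N : ℝ)) hN0 (mem_Ici.2 (by linarith)) h1
    have e2 := hf (a := x + n) (mem_Ici.2 (by linarith)) (mem_Ici.2 (by linarith)) h2
    have e3 := hg (a := (N : ℝ)) hN0 (mem_Ici.2 (by linarith)) h1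
    have e4 := hg (a := x + n) (mem_Ici.2 (by linarith)) (mem_Ici.2 (by linarith)) h2
    have e5 := hnat N
    have e6 := hnat (N + 1)
    push_cast at e6
    rw [← hper x hx n, abs_le]
    constructor <;> linarith
  have hlim' : Tendsto (fun n : ℕ => f (((n + ⌊x⌋₊ : ℕ) : ℝ) + 1) - f ((n + ⌊x⌋₊ : ℕ) : ℝ))
      atTop (𝓝 0) := hlim.comp (tendsto_add_atTop_nat ⌊x⌋₊)
  have h := ge_of_tendsto' hlim' hbound
  have := abs_nonpos_iff.1 h
  linarith

/-! ### Telescoping and series of inverse powers -/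

theorem hasSum_sub_of_antitone {t : ℕ → ℝ} (ht : Antitone t) {l : ℝ}
    (hl : Tendsto t atTop (𝓝 l)) : HasSum (fun n => t n - t (n + 1)) (t 0 - l) := by
  rw [hasSum_iff_tendsto_nat_of_nonneg fun n => sub_nonneg.2 (ht n.le_succ)]
  simp only [Finset.sum_range_sub']
  exact hl.const_sub _

theorem summable_one_div_nat_add_pow {m : ℕ} (hm : 2 ≤ m) {x : ℝ} (hx : 0 < x) :
    Summable fun n : ℕ => 1 / ((n : ℝ) + x) ^ m := by
  have := (Real.summable_one_div_nat_add_rpow x m).2 (by exact_mod_cast hm)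
  refine this.congr fun n => ?_
  rw [Real.rpow_natCast, abs_of_pos (by positivity)]

theorem tendsto_one_div_nat_add_pow {m : ℕ} (hm : 1 ≤ m) (x : ℝ) :
    Tendsto (fun n : ℕ => 1 / ((n : ℝ) + x) ^ m) atTop (𝓝 0) := by
  have h : Tendsto (fun n : ℕ => (n : ℝ) + x) atTop atTop :=
    tendsto_atTop_add_const_right _ _ tendsto_natCast_atTop_atTop
  simp only [one_div]
  exact ((tendsto_pow_atTop (by omega)).comp h).inv_tendsto_atTop

theorem hasSum_one_div_pow_sub_succ {m : ℕ} (hm : 1 ≤ m) {x : ℝ} (hx : 0 < x) :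
    HasSum (fun n : ℕ => 1 / ((n : ℝ) + x) ^ m - 1 / ((n : ℝ) + 1 + x) ^ m) (1 / x ^ m) := by
  have h := hasSum_sub_of_antitone (t := fun n : ℕ => 1 / ((n : ℝ) + x) ^ m)
    (fun i j hij => by
      have : (i : ℝ) ≤ j := by exact_mod_cast hij
      dsimp only
      gcongr) (tendsto_one_div_nat_add_pow hm x)
  simpa using h

theorem summable_one_div_pow_sub {m : ℕ} (hm : 1 ≤ m) {x : ℝ} (hx : 0 < x) :
    Summable fun n : ℕ => 1 / ((n : ℝ) + 1) ^ m - 1 / ((n : ℝ) + x) ^ m := by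
  rcases hm.eq_or_lt with rfl | hm
  -- For exponent 1 only the difference converges; it is |x-1|/((n+1)(n+x)), and `min 1 x` bounds
  -- both factors from below at once.
  · have hs := ((summable_one_div_nat_add_pow le_rfl (x := min 1 x) (by positivity)).mul_left |x - 1|)
    refine Summable.of_norm_bounded hs fun n => ?_
    have h1 : 0 < (n : ℝ) + 1 := by positivity
    have h2 : 0 < (n : ℝ) + x := by positivity
    have : 1 / ((n : ℝ) + 1) ^ 1 - 1 / ((n : ℝ) + x) ^ 1 =
        (x - 1) * (1 / (((n : ℝ) + 1) * ((n : ℝ) + x))) := by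
      field_simp; ring
    rw [this, norm_mul, Real.norm_eq_abs, Real.norm_eq_abs, abs_of_pos (by positivity : 0 < 1 / (((n : ℝ) + 1) * ((n : ℝ) + x)))]
    have h3 : 0 < (n : ℝ) + min 1 x := by positivity
    have : ((n : ℝ) + min 1 x) ^ 2 ≤ ((n : ℝ) + 1) * ((n : ℝ) + x) := by
      rw [sq]
      gcongr
      · exact min_le_left _ _
      · exact min_le_right _ _
    gcongr
  · exact (summable_one_div_nat_add_pow hm one_pos).sub (summable_one_div_nat_add_pow hm hx)

theorem hasDerivAt_tsum_one_div_pow_sub {m : ℕ} (hm : 1 ≤ m) {x : ℝ} (hx : 0 < x) :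
    HasDerivAt (fun y : ℝ => ∑' n : ℕ, (1 / ((n : ℝ) + 1) ^ m - 1 / ((n : ℝ) + y) ^ m))
      (∑' n : ℕ, m / ((n : ℝ) + x) ^ (m + 1)) x := by
  -- On (x/2, ∞) the differentiated terms have a summable bound independent of y, so termwise
  -- differentiation is allowed.
  have hx2 : 0 < x / 2 := by positivity
  have hu := (summable_one_div_nat_add_pow (m := m + 1) (by omega) hx2).mul_left (m : ℝ)
  have hpos : ∀ n : ℕ, ∀ y ∈ Ioi (x / 2), 0 < (n : ℝ) + y := fun n y hy => by
    have := hx2.trans (mem_Ioi.1 hy)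
    positivity
  have hderiv : ∀ n : ℕ, ∀ y ∈ Ioi (x / 2),
      HasDerivAt (fun y : ℝ => 1 / ((n : ℝ) + 1) ^ m - 1 / ((n : ℝ) + y) ^ m)
        (m / ((n : ℝ) + y) ^ (m + 1)) y := by
    intro n y hy
    have hy' := (hpos n y hy).ne'
    obtain ⟨k, rfl⟩ : ∃ k, m = k + 1 := ⟨m - 1, by omega⟩
    have h1 : HasDerivAt (fun y : ℝ => ((n : ℝ) + y) ^ (k + 1))
        (((k + 1 : ℕ) : ℝ) * ((n : ℝ) + y) ^ k * 1) y :=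
      ((hasDerivAt_id y).const_add (n : ℝ)).pow (k + 1)
    have h2 : HasDerivAt (fun y : ℝ => 1 / ((n : ℝ) + 1) ^ (k + 1) - (((n : ℝ) + y) ^ (k + 1))⁻¹)
        (-(-(((k + 1 : ℕ) : ℝ) * ((n : ℝ) + y) ^ k * 1) / (((n : ℝ) + y) ^ (k + 1)) ^ 2)) y :=
      (h1.fun_inv (pow_ne_zero _ hy')).const_sub _
    simp only [one_div] at h2 ⊢
    refine h2.congr_deriv ?_
    field_simp
    ring
  have hbound : ∀ n : ℕ, ∀ y ∈ Ioi (x / 2),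
      ‖(m : ℝ) / ((n : ℝ) + y) ^ (m + 1)‖ ≤ m * (1 / ((n : ℝ) + x / 2) ^ (m + 1)) := by
    intro n y hy
    have hy' := hpos n y hy
    rw [Real.norm_eq_abs, abs_of_nonneg (by positivity), mul_one_div]
    have := (mem_Ioi.1 hy).le
    gcongr
  have hxm : x ∈ Ioi (x / 2) := mem_Ioi.2 (by linarith)
  exact hasDerivAt_tsum_of_isPreconnected hu isOpen_Ioi isPreconnected_Ioi hderiv hbound hxm
    (summable_one_div_pow_sub hm hx) hxm

/-! ### Series for the digamma function and its derivatives -/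

theorem logDeriv_Gamma_add_one {x : ℝ} (hx : 0 < x) :
    logDeriv Real.Gamma (x + 1) = logDeriv Real.Gamma x + 1 / x := by
  have hd : ∀ y : ℝ, 0 < y → DifferentiableAt ℝ Real.Gamma y := fun y hy =>
    Real.differentiableAt_Gamma fun m => by
      have : (0 : ℝ) ≤ m := by positivity
      linarith
  have h1 : HasDerivAt (fun y => Real.Gamma (y + 1)) (deriv Real.Gamma (x + 1)) x :=
    (hd (x + 1) (by linarith)).hasDerivAt.comp_add_const x 1
  have h2 : HasDerivAt (fun y => y * Real.Gamma y)
      (1 * Real.Gamma x + x * deriv Real.Gamma x) x :=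
    (hasDerivAt_id x).mul (hd x hx).hasDerivAt
  have h3 : (fun y => Real.Gamma (y + 1)) =ᶠ[𝓝 x] fun y => y * Real.Gamma y := by
    filter_upwards [lt_mem_nhds hx] with y hy
    exact Real.Gamma_add_one hy.ne'
  have h4 := h1.unique (h2.congr_of_eventuallyEq h3)
  have hG := (Real.Gamma_pos_of_pos hx).ne'
  rw [logDeriv_apply, logDeriv_apply, h4, Real.Gamma_add_one hx.ne']
  field_simp
  ring

theorem monotoneOn_logDeriv_Gamma : MonotoneOn (logDeriv Real.Gamma) (Ioi 0) := by
  have hd : ∀ y : ℝ, 0 < y → DifferentiableAt ℝ Real.Gamma y := fun y hy =>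
    Real.differentiableAt_Gamma fun m => by
      have : (0 : ℝ) ≤ m := by positivity
      linarith
  have hd' : ∀ y : ℝ, y ∈ Ioi (0 : ℝ) → DifferentiableAt ℝ (Real.log ∘ Real.Gamma) y :=
    fun y hy => (Real.differentiableAt_log (Real.Gamma_pos_of_pos hy).ne').comp y (hd y hy)
  have h := Real.convexOn_log_Gamma.monotoneOn_deriv hd'
  refine h.congr fun y hy => ?_
  rw [logDeriv_apply]
  exact Real.deriv_log_comp_eq_logDeriv (hd y hy) (Real.Gamma_pos_of_pos hy).ne'

/-- Log-convexity of Γ makes ψ monotone, the series is monotone termwise, and both grow by 1/y from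
y to y+1, so the uniqueness principle applies. -/
theorem logDeriv_Gamma_eq_tsum {x : ℝ} (hx : 0 < x) :
    logDeriv Real.Gamma x =
      logDeriv Real.Gamma 1 + ∑' n : ℕ, (1 / ((n : ℝ) + 1) ^ 1 - 1 / ((n : ℝ) + x) ^ 1) := by
  set g : ℝ → ℝ := fun x => ∑' n : ℕ, (1 / ((n : ℝ) + 1) ^ 1 - 1 / ((n : ℝ) + x) ^ 1) with hg
  have hgsucc : ∀ y, 0 < y → g (y + 1) = g y + 1 / y := by
    intro y hy
    have h1 := (summable_one_div_pow_sub le_rfl hy).hasSum.add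
      (hasSum_one_div_pow_sub_succ le_rfl hy)
    rw [pow_one y] at h1
    rw [← h1.tsum_eq]
    refine tsum_congr fun n => ?_
    ring
  -- The argument is shifted by one because the principle lives on [0, ∞), where ψ is singular at 0;
  -- the recurrence then steps back to x.
  have key : ∀ y, 0 ≤ y → logDeriv Real.Gamma (y + 1) - logDeriv Real.Gamma 1 = g (y + 1) := by
    intro y hy
    refine eq_of_monotoneOn_of_increments
      (f := fun y => logDeriv Real.Gamma (y + 1) - logDeriv Real.Gamma 1)
      (g := fun y => g (y + 1)) ?_ ?_ ?_ ?_ ?_ hy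
    · intro u hu v hv huv
      have := monotoneOn_logDeriv_Gamma (a := u + 1) (b := v + 1)
        (mem_Ioi.2 (by linarith [mem_Ici.1 hu])) (mem_Ioi.2 (by linarith [mem_Ici.1 hv]))
        (by linarith)
      dsimp only
      linarith
    · intro u hu v hv huv
      have hu' := mem_Ici.1 hu
      have hv' := mem_Ici.1 hv
      refine (summable_one_div_pow_sub le_rfl (by linarith)).tsum_le_tsum (fun n => ?_)
        (summable_one_div_pow_sub le_rfl (by linarith))
      have : 0 < (n : ℝ) + (u + 1) := by positivity
      gcongr
    · intro u hu
      rw [logDeriv_Gamma_add_one (by linarith : 0 < u + 1), hgsucc _ (by linarith)]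
      ring
    · have h : ∀ n : ℕ, logDeriv Real.Gamma ((n : ℝ) + 1 + 1) - logDeriv Real.Gamma 1 -
          (logDeriv Real.Gamma ((n : ℝ) + 1) - logDeriv Real.Gamma 1) = 1 / ((n : ℝ) + 1) := by
        intro n
        rw [logDeriv_Gamma_add_one (by positivity : (0 : ℝ) < (n : ℝ) + 1)]
        ring
      simp only [h]
      exact tendsto_one_div_add_atTop_nhds_zero_nat
    · simp [hg]
  have h1 := key x hx.le
  rw [logDeriv_Gamma_add_one hx, hgsucc x hx] at h1
  linarith

theorem realPolygamma_zero {x : ℝ} (hx : 0 < x) :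
    realPolygamma 0 x =
      logDeriv Real.Gamma 1 + ∑' n : ℕ, (1 / ((n : ℝ) + 1) ^ 1 - 1 / ((n : ℝ) + x) ^ 1) := by
  rw [realPolygamma, iteratedDeriv_zero, logDeriv_Gamma_eq_tsum hx]

theorem realPolygamma_one {x : ℝ} (hx : 0 < x) :
    realPolygamma 1 x = ∑' n : ℕ, 1 / ((n : ℝ) + x) ^ 2 := by
  have h : logDeriv Real.Gamma =ᶠ[𝓝 x] fun x =>
      logDeriv Real.Gamma 1 + ∑' n : ℕ, (1 / ((n : ℝ) + 1) ^ 1 - 1 / ((n : ℝ) + x) ^ 1) := by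
    filter_upwards [lt_mem_nhds hx] with y hy
    exact logDeriv_Gamma_eq_tsum hy
  rw [realPolygamma, iteratedDeriv_one, h.deriv_eq]
  have := ((hasDerivAt_tsum_one_div_pow_sub le_rfl hx).const_add (logDeriv Real.Gamma 1)).deriv
  simpa using this

theorem realPolygamma_two {x : ℝ} (hx : 0 < x) :
    realPolygamma 2 x = -2 * ∑' n : ℕ, 1 / ((n : ℝ) + x) ^ 3 := by
  have h : realPolygamma 1 =ᶠ[𝓝 x] fun y => (∑' n : ℕ, 1 / ((n : ℝ) + 1) ^ 2) -
      ∑' n : ℕ, (1 / ((n : ℝ) + 1) ^ 2 - 1 / ((n : ℝ) + y) ^ 2) := by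
    filter_upwards [lt_mem_nhds hx] with y hy
    rw [realPolygamma_one hy, (summable_one_div_nat_add_pow le_rfl one_pos).tsum_sub
      (summable_one_div_nat_add_pow le_rfl hy)]
    ring
  have h2 : realPolygamma 2 x = deriv (realPolygamma 1) x := by
    simp only [realPolygamma]
    rw [iteratedDeriv_succ]
    rfl
  rw [h2, h.deriv_eq, ((hasDerivAt_tsum_one_div_pow_sub one_le_two hx).const_sub _).deriv,
    ← tsum_mul_left, ← tsum_neg]
  refine tsum_congr fun n => ?_
  push_cast
  ring

/-! ### Shifted and ordinary harmonic numbers -/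

theorem hasSum_shiftedHarmonic {m : ℕ} (hm : m ∈ Finset.Icc 1 3) {a : ℝ} (ha : 0 ≤ a) :
    HasSum (fun n : ℕ => 1 / ((n : ℝ) + 1) ^ m - 1 / ((n : ℝ) + 1 + a) ^ m)
      (shiftedHarmonic m a) := by
  have ha1 : 0 < a + 1 := by linarith
  obtain ⟨h1, h3⟩ := Finset.mem_Icc.1 hm
  have hs := summable_one_div_pow_sub h1 ha1
  have hcomm : ∀ n : ℕ, (n : ℝ) + (a + 1) = (n : ℝ) + 1 + a := fun n => by ring
  have hval : shiftedHarmonic m a =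
      ∑' n : ℕ, (1 / ((n : ℝ) + 1) ^ m - 1 / ((n : ℝ) + (a + 1)) ^ m) := by
    have hts : ∀ k, 2 ≤ k → ∑' n : ℕ, (1 / ((n : ℝ) + 1) ^ k - 1 / ((n : ℝ) + (a + 1)) ^ k) =
        ∑' n : ℕ, 1 / ((n : ℝ) + 1) ^ k - ∑' n : ℕ, 1 / ((n : ℝ) + (a + 1)) ^ k := fun k hk =>
      (summable_one_div_nat_add_pow hk one_pos).tsum_sub (summable_one_div_nat_add_pow hk ha1)
    interval_cases m
    · simp [shiftedHarmonic, realPolygamma_zero ha1, realPolygamma_zero one_pos]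
    · rw [hts 2 le_rfl]
      simp [shiftedHarmonic, realPolygamma_one ha1, realPolygamma_one one_pos]
    · rw [hts 3 (by norm_num)]
      simp [shiftedHarmonic, realPolygamma_two ha1, realPolygamma_two one_pos]
      ring
  rw [hval]
  simpa only [hcomm] using hs.hasSum

theorem shiftedHarmonic_zero (m : ℕ) : shiftedHarmonic m 0 = 0 := by
  simp [shiftedHarmonic]

theorem shiftedHarmonic_add_one {m : ℕ} (hm : m ∈ Finset.Icc 1 3) {a : ℝ} (ha : 0 ≤ a) :
    shiftedHarmonic m (a + 1) = shiftedHarmonic m a + 1 / (a + 1) ^ m := by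
  have ha1 : 0 < a + 1 := by linarith
  have h1 := (hasSum_shiftedHarmonic hm ha).add
    (hasSum_one_div_pow_sub_succ (Finset.mem_Icc.1 hm).1 ha1)
  refine (hasSum_shiftedHarmonic hm ha1.le).unique (h1.congr_fun fun n => ?_)
  ring_nf

theorem shiftedHarmonic_monotoneOn {m : ℕ} (hm : m ∈ Finset.Icc 1 3) :
    MonotoneOn (shiftedHarmonic m) (Ici 0) := by
  intro u hu v hv huv
  have hu' := mem_Ici.1 hu
  refine hasSum_le (fun n => ?_) (hasSum_shiftedHarmonic hm hu) (hasSum_shiftedHarmonic hm hv)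
  have : 0 < (n : ℝ) + 1 + u := by positivity
  gcongr

theorem shiftedHarmonic_nonneg {m : ℕ} (hm : m ∈ Finset.Icc 1 3) {a : ℝ} (ha : 0 ≤ a) :
    0 ≤ shiftedHarmonic m a := by
  rw [← shiftedHarmonic_zero m]
  exact shiftedHarmonic_monotoneOn hm self_mem_Ici ha ha

theorem harmonicOfOrder_zero (s : ℕ) : harmonicOfOrder s 0 = 0 := by
  simp [harmonicOfOrder]

theorem harmonicOfOrder_succ (s n : ℕ) :
    harmonicOfOrder s (n + 1) = harmonicOfOrder s n + 1 / ((n : ℝ) + 1) ^ s := by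
  rw [harmonicOfOrder, Finset.sum_Icc_succ_top (by omega), harmonicOfOrder]
  push_cast
  rfl

theorem harmonicOfOrder_nonneg (s n : ℕ) : 0 ≤ harmonicOfOrder s n :=
  Finset.sum_nonneg fun _ _ => by positivity

theorem harmonicOfOrder_monotone (s : ℕ) : Monotone (harmonicOfOrder s) :=
  monotone_nat_of_le_succ fun n => by
    rw [harmonicOfOrder_succ]
    have : 0 ≤ 1 / ((n : ℝ) + 1) ^ s := by positivity
    linarith

theorem one_le_harmonicOfOrder (s n : ℕ) : 1 ≤ harmonicOfOrder s (n + 1) := by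
  have := harmonicOfOrder_monotone s (Nat.succ_le_succ n.zero_le)
  rw [Nat.succ_eq_add_one, harmonicOfOrder_succ, harmonicOfOrder_zero] at this
  simpa using this

theorem harmonicOfOrder_two_le (n : ℕ) : harmonicOfOrder 2 n ≤ harmonicOfOrder 1 n := by
  refine Finset.sum_le_sum fun i hi => ?_
  have h1 : (1 : ℝ) ≤ i := by exact_mod_cast (Finset.mem_Icc.1 hi).1
  exact one_div_le_one_div_of_le (by positivity) (pow_le_pow_right₀ h1 one_le_two)

theorem shiftedHarmonic_natCast {m : ℕ} (hm : m ∈ Finset.Icc 1 3) (n : ℕ) :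
    shiftedHarmonic m n = harmonicOfOrder m n := by
  induction n with
  | zero => simp [shiftedHarmonic_zero, harmonicOfOrder_zero]
  | succ n ih =>
    push_cast
    rw [shiftedHarmonic_add_one hm n.cast_nonneg, ih, harmonicOfOrder_succ]

/-- From H_n ≤ 1 + log n and log n ≤ 8 n^(1/8) follows H_n ≤ 9 n^(1/8), and 729 = 9^3. Any power of
n below 1 would serve for convergence and for the vanishing boundary terms. -/
theorem harmonicOfOrder_one_pow_le {j : ℕ} (hj : j ∈ Finset.Icc 1 3) (n : ℕ) :
    harmonicOfOrder 1 n ^ j ≤ 729 * √n := by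
  obtain ⟨hj1, hj3⟩ := Finset.mem_Icc.1 hj
  rcases n with - | n
  · simp [harmonicOfOrder_zero, show j ≠ 0 by omega]
  have hx : (1 : ℝ) ≤ ((n + 1 : ℕ) : ℝ) := by push_cast; linarith [n.cast_nonneg (α := ℝ)]
  set x : ℝ := ((n + 1 : ℕ) : ℝ) with hxdef
  have hx0 : 0 ≤ x := by linarith
  have h1 : harmonicOfOrder 1 (n + 1) ≤ 1 + Real.log x := by
    have h := harmonic_le_one_add_log (n + 1)
    have e : ((harmonic (n + 1) : ℚ) : ℝ) = harmonicOfOrder 1 (n + 1) := by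
      rw [harmonic_eq_sum_Icc, harmonicOfOrder]
      push_cast
      simp
    rwa [e] at h
  have h2 : Real.log x ≤ x ^ (1 / 8 : ℝ) / (1 / 8) := Real.log_le_rpow_div hx0 (by norm_num)
  have h3 : 1 ≤ x ^ (1 / 8 : ℝ) := Real.one_le_rpow hx (by norm_num)
  have h4 : harmonicOfOrder 1 (n + 1) ≤ 9 * x ^ (1 / 8 : ℝ) := by linarith
  calc harmonicOfOrder 1 (n + 1) ^ j ≤ harmonicOfOrder 1 (n + 1) ^ 3 :=
        pow_le_pow_right₀ (one_le_harmonicOfOrder 1 n) hj3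
    _ ≤ (9 * x ^ (1 / 8 : ℝ)) ^ 3 := by
        gcongr
        exact harmonicOfOrder_nonneg _ _
    _ = 729 * x ^ (3 / 8 : ℝ) := by
        rw [mul_pow, ← Real.rpow_natCast (x ^ (1 / 8 : ℝ)), ← Real.rpow_mul hx0]
        norm_num
    _ ≤ 729 * √x := by
        rw [Real.sqrt_eq_rpow]
        have := Real.rpow_le_rpow_of_exponent_le hx (by norm_num : (3 / 8 : ℝ) ≤ 1 / 2)
        gcongr

theorem summable_sqrt_div_sq : Summable fun n : ℕ => √((n : ℝ) + 1) / ((n : ℝ) + 1) ^ 2 := by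
  have h := (Real.summable_one_div_nat_add_rpow 1 (3 / 2)).2 (by norm_num)
  refine h.congr fun n => ?_
  have hn : 0 < (n : ℝ) + 1 := by positivity
  rw [abs_of_pos hn, Real.sqrt_eq_rpow, ← Real.rpow_natCast, ← Real.rpow_sub hn,
    one_div, ← Real.rpow_neg hn.le]
  norm_num

theorem summable_harmonicOfOrder_one_pow_mul {j : ℕ} (hj : j ∈ Finset.Icc 1 3) {w : ℕ → ℝ} {C : ℝ}
    (hw0 : ∀ n, 0 ≤ w n) (hw : ∀ n : ℕ, w n ≤ C / ((n : ℝ) + 1) ^ 2) :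
    Summable fun n => harmonicOfOrder 1 (n + 1) ^ j * w n := by
  refine Summable.of_nonneg_of_le
    (fun n => mul_nonneg (pow_nonneg (harmonicOfOrder_nonneg _ _) _) (hw0 n)) (fun n => ?_)
    (summable_sqrt_div_sq.mul_left (729 * C))
  have h := harmonicOfOrder_one_pow_le hj (n + 1)
  push_cast at h
  calc _ ≤ (729 * √((n : ℝ) + 1)) * (C / ((n : ℝ) + 1) ^ 2) :=
        mul_le_mul h (hw n) (hw0 n) (by positivity)
    _ = _ := by ring

theorem tendsto_harmonicOfOrder_one_pow_div {j : ℕ} (hj : j ∈ Finset.Icc 1 3) {c : ℝ}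
    (hc : 0 < c) : Tendsto (fun n : ℕ => harmonicOfOrder 1 n ^ j * (1 / ((n : ℝ) + c))) atTop (𝓝 0) := by
  have hlim : Tendsto (fun n : ℕ => 729 * (√(n : ℝ))⁻¹) atTop (𝓝 0) := by
    have h : Tendsto (fun n : ℕ => √(n : ℝ)) atTop atTop :=
      Real.tendsto_sqrt_atTop.comp tendsto_natCast_atTop_atTop
    simpa using (tendsto_inv_atTop_zero.comp h).const_mul 729
  refine squeeze_zero (fun n => ?_) (fun n => ?_) hlim
  · have := pow_nonneg (harmonicOfOrder_nonneg 1 n) j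
    positivity
  · rcases n with - | n
    · simp [harmonicOfOrder_zero, show j ≠ 0 by have := (Finset.mem_Icc.1 hj).1; omega]
    · set x : ℝ := ((n + 1 : ℕ) : ℝ) with hxdef
      have hx : 0 < x := by positivity
      have hs : 0 < √x := by positivity
      calc harmonicOfOrder 1 (n + 1) ^ j * (1 / (x + c)) ≤ (729 * √x) * (1 / x) := by
            refine mul_le_mul (harmonicOfOrder_one_pow_le hj _) ?_ (by positivity) (by positivity)
            exact one_div_le_one_div_of_le hx (by linarith)
        _ = 729 * (√x)⁻¹ := by
            field_simp
            rw [Real.sq_sqrt hx.le]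

/-! ### Summation by parts -/

/-- Summation by parts for an increasing sequence against a decreasing one. -/
theorem hasSum_mul_sub_of_monotone {X t : ℕ → ℝ} (hX0 : X 0 = 0) (hX : Monotone X)
    (ht : Antitone t) (hlim : Tendsto (fun n => X n * t n) atTop (𝓝 0)) {s : ℝ}
    (hs : HasSum (fun n => (X (n + 1) - X n) * t n) s) :
    HasSum (fun n => X (n + 1) * (t n - t (n + 1))) s := by
  rw [hasSum_iff_tendsto_nat_of_nonneg]
  · have h : ∀ N, ∑ n ∈ Finset.range N, X (n + 1) * (t n - t (n + 1)) =
        ∑ n ∈ Finset.range N, (X (n + 1) - X n) * t n - X N * t N := by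
      intro N
      induction N with
      | zero => simp [hX0]
      | succ N ih =>
        rw [Finset.sum_range_succ, Finset.sum_range_succ, ih]
        ring
    simp only [h]
    simpa using hs.tendsto_sum_nat.sub hlim
  · intro n
    have h1 : X 0 ≤ X (n + 1) := hX (Nat.zero_le _)
    exact mul_nonneg (by linarith) (sub_nonneg.2 (ht n.le_succ))

theorem antitone_one_div_nat_add {c : ℝ} (hc : 0 < c) :
    Antitone fun n : ℕ => 1 / ((n : ℝ) + c) := fun i j hij => by
  have : (i : ℝ) ≤ j := by exact_mod_cast hij
  dsimp only
  gcongr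

theorem hasSum_harmonicOfOrder_one_pow_by_parts {j : ℕ} (hj : j ∈ Finset.Icc 1 3) {c : ℝ}
    (hc : 0 < c) {s : ℝ}
    (hs : HasSum (fun n : ℕ => (harmonicOfOrder 1 (n + 1) ^ j - harmonicOfOrder 1 n ^ j) *
      (1 / ((n : ℝ) + c))) s) :
    HasSum (fun n : ℕ => harmonicOfOrder 1 (n + 1) ^ j *
      (1 / ((n : ℝ) + c) - 1 / ((n : ℝ) + 1 + c))) s := by
  have h := hasSum_mul_sub_of_monotone (X := fun n => harmonicOfOrder 1 n ^ j)
    (by simp [harmonicOfOrder_zero, show j ≠ 0 by have := (Finset.mem_Icc.1 hj).1; omega])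
    (fun m n hmn => pow_le_pow_left₀ (harmonicOfOrder_nonneg _ _) (harmonicOfOrder_monotone 1 hmn) j)
    (antitone_one_div_nat_add hc) (tendsto_harmonicOfOrder_one_pow_div hj hc) hs
  simpa using h

/-! ### Zeta values and elementary partial fractions -/

theorem hasSum_zetaValue {m : ℕ} (hm : 2 ≤ m) :
    HasSum (fun n : ℕ => 1 / ((n : ℝ) + 1) ^ m) (zetaValue m) := by
  have hs := summable_one_div_nat_add_pow hm one_pos
  convert hs.hasSum using 1
  rw [zetaValue, zeta_eq_tsum_one_div_nat_add_one_cpow (by simpa using (by omega : 1 < m))]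
  have : ∀ n : ℕ, 1 / ((n : ℂ) + 1) ^ (m : ℂ) = ((1 / ((n : ℝ) + 1) ^ m : ℝ) : ℂ) := by
    intro n
    rw [Complex.cpow_natCast]
    push_cast
    rfl
  simp only [this]
  rw [← Complex.ofReal_tsum, Complex.ofReal_re]

theorem one_div_sub_one_div_eq {x a : ℝ} (hx : 0 < x) (ha : 0 ≤ a) :
    1 / x - 1 / (x + a) = a * (1 / (x * (x + a))) := by
  have : 0 < x + a := by positivity
  field_simp
  ring

theorem hasSum_shiftedHarmonic_one {a : ℝ} (ha : 0 ≤ a) :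
    HasSum (fun n : ℕ => 1 / ((n : ℝ) + 1) - 1 / ((n : ℝ) + 1 + a)) (shiftedHarmonic 1 a) := by
  simpa only [pow_one] using hasSum_shiftedHarmonic (m := 1) (by simp) ha

theorem hasSum_one_div_mul {a : ℝ} (ha : 0 < a) :
    HasSum (fun n : ℕ => 1 / (((n : ℝ) + 1) * ((n : ℝ) + 1 + a))) (shiftedHarmonic 1 a / a) := by
  refine ((hasSum_shiftedHarmonic_one ha.le).div_const a).congr_fun fun n => ?_
  rw [one_div_sub_one_div_eq (by positivity) ha.le]
  field_simp

theorem hasSum_one_div_sq_mul {a : ℝ} (ha : 0 < a) :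
    HasSum (fun n : ℕ => 1 / (((n : ℝ) + 1) ^ 2 * ((n : ℝ) + 1 + a)))
      ((zetaValue 2 - shiftedHarmonic 1 a / a) / a) := by
  refine (((hasSum_zetaValue le_rfl).sub (hasSum_one_div_mul ha)).div_const a).congr_fun fun n => ?_
  have : 0 < (n : ℝ) + 1 + a := by positivity
  field_simp
  ring

/-! ### Harmonic power sums with exponent 1 -/

/-- `∑ H_n^j (1/n - 1/(n+a))`. -/
noncomputable def harmonicPowerSum (j : ℕ) (a : ℝ) : ℝ :=
  ∑' n : ℕ, harmonicOfOrder 1 (n + 1) ^ j * (1 / ((n : ℝ) + 1) - 1 / ((n : ℝ) + 1 + a))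

theorem hasSum_harmonicPowerSum {j : ℕ} (hj : j ∈ Finset.Icc 1 3) {a : ℝ} (ha : 0 ≤ a) :
    HasSum (fun n : ℕ => harmonicOfOrder 1 (n + 1) ^ j *
      (1 / ((n : ℝ) + 1) - 1 / ((n : ℝ) + 1 + a))) (harmonicPowerSum j a) := by
  refine (summable_harmonicOfOrder_one_pow_mul (C := a) hj (fun n => ?_) fun n => ?_).hasSum
  all_goals rw [one_div_sub_one_div_eq (by positivity) ha]
  · positivity
  · rw [← mul_one_div a]
    gcongr
    nlinarith [n.cast_nonneg (α := ℝ)]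

theorem harmonicPowerSum_monotoneOn {j : ℕ} (hj : j ∈ Finset.Icc 1 3) :
    MonotoneOn (harmonicPowerSum j) (Ici 0) := by
  intro u hu v hv huv
  have hu' := mem_Ici.1 hu
  refine hasSum_le (fun n => ?_) (hasSum_harmonicPowerSum hj hu) (hasSum_harmonicPowerSum hj hv)
  have : 0 < (n : ℝ) + 1 + u := by positivity
  have := harmonicOfOrder_nonneg 1 (n + 1)
  gcongr

/-- The difference of the two series is Σ H_n^j (1/(n+a) - 1/(n+1+a)), to which summation by parts
applies. -/
theorem harmonicPowerSum_add_one {j : ℕ} (hj : j ∈ Finset.Icc 1 3) {a s : ℝ} (ha : 0 ≤ a)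
    (hs : HasSum (fun n : ℕ => (harmonicOfOrder 1 (n + 1) ^ j - harmonicOfOrder 1 n ^ j) *
      (1 / ((n : ℝ) + 1 + a))) s) :
    harmonicPowerSum j (a + 1) = harmonicPowerSum j a + s := by
  have h := hasSum_harmonicOfOrder_one_pow_by_parts hj (c := 1 + a) (by positivity) (s := s)
    (by simpa only [add_assoc] using hs)
  have h2 := (hasSum_harmonicPowerSum hj (by positivity : 0 ≤ a + 1)).sub
    (hasSum_harmonicPowerSum hj ha)
  have h3 := h.unique (h2.congr_fun fun n => by ring_nf)
  linarith

theorem harmonicPowerSum_one_add_one {a : ℝ} (ha : 0 < a) :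
    harmonicPowerSum 1 (a + 1) = harmonicPowerSum 1 a + shiftedHarmonic 1 a / a := by
  refine harmonicPowerSum_add_one (by simp) ha.le ((hasSum_one_div_mul ha).congr_fun fun n => ?_)
  rw [harmonicOfOrder_succ]
  have : 0 < (n : ℝ) + 1 + a := by positivity
  field_simp
  ring

theorem harmonicPowerSum_one_one : harmonicPowerSum 1 1 = zetaValue 2 := by
  have h := harmonicPowerSum_add_one (j := 1) (a := 0) (s := zetaValue 2) (by simp) le_rfl
    ((hasSum_zetaValue le_rfl).congr_fun fun n => by
      rw [harmonicOfOrder_succ]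
      have : 0 < (n : ℝ) + 1 := by positivity
      field_simp
      ring)
  simpa [harmonicPowerSum] using h

/-- Both sides increase by H_{u+1}/(u+1) from u to u+1. The shift to a+1 avoids the quotient H_a/a
at a = 0. -/
theorem harmonicPowerSum_one_eq {a : ℝ} (ha : 0 ≤ a) :
    harmonicPowerSum 1 (a + 1) =
      (shiftedHarmonic 1 a ^ 2 + shiftedHarmonic 2 a) / 2 + zetaValue 2 := by
  have hinc : ∀ u, 0 ≤ u → harmonicPowerSum 1 (u + 1 + 1) - harmonicPowerSum 1 (u + 1) =
      shiftedHarmonic 1 (u + 1) / (u + 1) := fun u hu => by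
    rw [harmonicPowerSum_one_add_one (by positivity : 0 < u + 1)]
    ring
  refine eq_of_monotoneOn_of_increments (f := fun a => harmonicPowerSum 1 (a + 1))
    (g := fun a => (shiftedHarmonic 1 a ^ 2 + shiftedHarmonic 2 a) / 2 + zetaValue 2)
    ?_ ?_ ?_ ?_ ?_ ha
  · intro u hu v hv huv
    have hu' := mem_Ici.1 hu
    have hv' := mem_Ici.1 hv
    exact harmonicPowerSum_monotoneOn (by simp) (mem_Ici.2 (by linarith))
      (mem_Ici.2 (by linarith)) (by linarith)
  · intro u hu v hv huv
    have h1 := shiftedHarmonic_monotoneOn (m := 1) (by simp) hu hv huv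
    have h2 := shiftedHarmonic_monotoneOn (m := 2) (by simp) hu hv huv
    have h3 := shiftedHarmonic_nonneg (m := 1) (by simp) hu
    dsimp only
    gcongr
  · intro u hu
    rw [hinc u hu, shiftedHarmonic_add_one (by simp) hu, shiftedHarmonic_add_one (by simp) hu]
    have : 0 < u + 1 := by positivity
    field_simp
    ring
  · have h : ∀ n : ℕ, harmonicPowerSum 1 ((n : ℝ) + 1 + 1) - harmonicPowerSum 1 ((n : ℝ) + 1) =
        harmonicOfOrder 1 (n + 1) ^ 1 * (1 / (((n + 1 : ℕ) : ℝ))) := fun n => by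
      rw [hinc n n.cast_nonneg, ← shiftedHarmonic_natCast (by simp)]
      push_cast
      ring
    -- The factor 2 comes from 1/n ≤ 2/(n+1) for n ≥ 1; the term n = 0 vanishes because H_0 = 0.
    have hlim := squeeze_zero (g := fun n : ℕ => 2 * (harmonicOfOrder 1 n ^ 1 * (1 / ((n : ℝ) + 1))))
      (f := fun n : ℕ => harmonicOfOrder 1 n ^ 1 * (1 / (n : ℝ)))
      (fun n => by have := harmonicOfOrder_nonneg 1 n; positivity)
      (fun n => by
        have := harmonicOfOrder_nonneg 1 n
        rcases n with - | n
        · simp [harmonicOfOrder_zero]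
        rw [mul_left_comm]
        gcongr
        push_cast
        rw [mul_one_div, div_le_div_iff₀ (by positivity) (by positivity)]
        linarith [n.cast_nonneg (α := ℝ)])
      (by simpa using (tendsto_harmonicOfOrder_one_pow_div (j := 1) (by simp) one_pos).const_mul 2)
    simp only [h]
    exact hlim.comp (tendsto_add_atTop_nat 1)
  · simp [shiftedHarmonic_zero, harmonicPowerSum_one_one]

theorem harmonicPowerSum_one_eq_sub {a : ℝ} (ha : 0 < a) :
    harmonicPowerSum 1 a = (shiftedHarmonic 1 a ^ 2 + shiftedHarmonic 2 a) / 2 + zetaValue 2 -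
      shiftedHarmonic 1 a / a := by
  rw [← harmonicPowerSum_one_eq ha.le, harmonicPowerSum_one_add_one ha]
  ring

/-! ### The linear sum and harmonic power sums with exponent 2 -/

theorem shiftedHarmonic_one_natCast_add_le {a : ℝ} (ha : 0 ≤ a) (n : ℕ) :
    shiftedHarmonic 1 ((n : ℝ) + a) ≤ shiftedHarmonic 1 a + harmonicOfOrder 1 n := by
  induction n with
  | zero => simp [harmonicOfOrder_zero]
  | succ n ih =>
    push_cast
    rw [add_right_comm, shiftedHarmonic_add_one (by simp) (by positivity), harmonicOfOrder_succ]
    have : 1 / ((n : ℝ) + a + 1) ^ 1 ≤ 1 / ((n : ℝ) + 1) ^ 1 := by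
      gcongr
      linarith
    linarith

theorem linearSum_eq_tsum (a : ℝ) :
    linearSum a = ∑' n : ℕ, shiftedHarmonic 1 ((n : ℝ) + 1 + a) / ((n : ℝ) + 1) ^ 2 := by
  rw [linearSum, ← Equiv.pnatEquivNat.symm.tsum_eq]
  simp [Equiv.pnatEquivNat]

theorem hasSum_linearSum {a : ℝ} (ha : 0 ≤ a) :
    HasSum (fun n : ℕ => shiftedHarmonic 1 ((n : ℝ) + 1 + a) / ((n : ℝ) + 1) ^ 2)
      (linearSum a) := by
  rw [linearSum_eq_tsum]
  have h1 := summable_harmonicOfOrder_one_pow_mul (j := 1) (C := 1) (by simp)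
    (w := fun n : ℕ => 1 / ((n : ℝ) + 1) ^ 2) (fun n => by positivity) fun n => le_rfl
  have h2 := (hasSum_zetaValue le_rfl).summable.mul_left (shiftedHarmonic 1 a)
  refine (Summable.of_nonneg_of_le (fun n => ?_) (fun n => ?_) (h2.add h1)).hasSum
  · have := shiftedHarmonic_nonneg (m := 1) (by simp) (by positivity : 0 ≤ (n : ℝ) + 1 + a)
    positivity
  · have := shiftedHarmonic_one_natCast_add_le ha (n + 1)
    push_cast at this
    rw [pow_one, ← add_mul, mul_one_div]
    gcongr

theorem linearSum_monotoneOn : MonotoneOn linearSum (Ici 0) := by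
  intro u hu v hv huv
  have hu' := mem_Ici.1 hu
  have hv' := mem_Ici.1 hv
  refine hasSum_le (fun n => ?_) (hasSum_linearSum hu) (hasSum_linearSum hv)
  have := shiftedHarmonic_monotoneOn (m := 1) (by simp) (a := (n : ℝ) + 1 + u)
    (b := (n : ℝ) + 1 + v) (mem_Ici.2 (by positivity)) (mem_Ici.2 (by positivity)) (by linarith)
  gcongr

theorem linearSum_add_one {a : ℝ} (ha : 0 ≤ a) :
    linearSum (a + 1) = linearSum a +
      (zetaValue 2 - shiftedHarmonic 1 (a + 1) / (a + 1)) / (a + 1) := by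
  have ha1 : 0 < a + 1 := by positivity
  refine (hasSum_linearSum ha1.le).unique
    (((hasSum_linearSum ha).add (hasSum_one_div_sq_mul ha1)).congr_fun fun n => ?_)
  have : 0 < (n : ℝ) + 1 + (a + 1) := by positivity
  rw [show (n : ℝ) + 1 + (a + 1) = (n : ℝ) + 1 + a + 1 by ring,
    shiftedHarmonic_add_one (by simp) (by positivity)]
  field_simp

theorem hasSum_harmonic_div_sq :
    HasSum (fun n : ℕ => harmonicOfOrder 1 (n + 1) / ((n : ℝ) + 1) ^ 2) (linearSum 0) := by
  refine (hasSum_linearSum le_rfl).congr_fun fun n => ?_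
  rw [← shiftedHarmonic_natCast (by simp)]
  push_cast
  simp

theorem harmonicPowerSum_two_add_one {a : ℝ} (ha : 0 < a) :
    harmonicPowerSum 2 (a + 1) = harmonicPowerSum 2 a +
      (2 * harmonicPowerSum 1 a - zetaValue 2 + shiftedHarmonic 1 a / a) / a := by
  refine harmonicPowerSum_add_one (by simp) ha.le (((((hasSum_harmonicPowerSum (j := 1) (by simp)
    ha.le).mul_left 2).sub (hasSum_zetaValue le_rfl)).add
      (hasSum_one_div_mul ha)).div_const a |>.congr_fun fun n => ?_)
  have : 0 < (n : ℝ) + 1 + a := by positivity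
  rw [harmonicOfOrder_succ]
  field_simp
  ring

theorem harmonicPowerSum_two_one :
    harmonicPowerSum 2 1 = 2 * linearSum 0 - zetaValue 3 := by
  have h := harmonicPowerSum_add_one (j := 2) (a := 0) (s := 2 * linearSum 0 - zetaValue 3)
    (by simp) le_rfl
    (((hasSum_harmonic_div_sq.mul_left 2).sub (hasSum_zetaValue (by norm_num))).congr_fun
      fun n => by
        rw [harmonicOfOrder_succ]
        have : 0 < (n : ℝ) + 1 := by positivity
        field_simp
        ring)
  simpa [harmonicPowerSum] using h

/-- The cubic part has increment (H_{u+1}^2 + H_{u+1}^(2))/(u+1). What remains of the required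
increment is (ζ(2) - H_{u+1}/(u+1))/(u+1), exactly that of `linearSum`. -/
theorem harmonicPowerSum_two_eq {a : ℝ} (ha : 0 ≤ a) :
    harmonicPowerSum 2 (a + 1) =
      (shiftedHarmonic 1 a ^ 3 + 3 * (shiftedHarmonic 1 a * shiftedHarmonic 2 a) +
        2 * shiftedHarmonic 3 a) / 3 + linearSum a + (linearSum 0 - zetaValue 3) := by
  have hinc : ∀ u, 0 ≤ u → harmonicPowerSum 2 (u + 1 + 1) - harmonicPowerSum 2 (u + 1) =
      (shiftedHarmonic 1 u ^ 2 + shiftedHarmonic 2 u + zetaValue 2 +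
        shiftedHarmonic 1 (u + 1) / (u + 1)) / (u + 1) := fun u hu => by
    rw [harmonicPowerSum_two_add_one (by positivity : 0 < u + 1), harmonicPowerSum_one_eq hu]
    ring
  refine eq_of_monotoneOn_of_increments (f := fun a => harmonicPowerSum 2 (a + 1))
    (g := fun a => (shiftedHarmonic 1 a ^ 3 + 3 * (shiftedHarmonic 1 a * shiftedHarmonic 2 a) +
        2 * shiftedHarmonic 3 a) / 3 + linearSum a + (linearSum 0 - zetaValue 3))
    ?_ ?_ ?_ ?_ ?_ ha
  · intro u hu v hv huv
    have hu' := mem_Ici.1 hu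
    have hv' := mem_Ici.1 hv
    exact harmonicPowerSum_monotoneOn (by simp) (mem_Ici.2 (by linarith))
      (mem_Ici.2 (by linarith)) (by linarith)
  · intro u hu v hv huv
    have h1 := shiftedHarmonic_monotoneOn (m := 1) (by simp) hu hv huv
    have h2 := shiftedHarmonic_monotoneOn (m := 2) (by simp) hu hv huv
    have h3 := shiftedHarmonic_monotoneOn (m := 3) (by simp) hu hv huv
    have h4 := shiftedHarmonic_nonneg (m := 1) (by simp) hu
    have h5 := shiftedHarmonic_nonneg (m := 2) (by simp) hu
    have h6 := linearSum_monotoneOn hu hv huv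
    have h7 := h4.trans h1
    dsimp only
    gcongr
  · intro u hu
    rw [hinc u hu, linearSum_add_one hu, shiftedHarmonic_add_one (by simp) hu,
      shiftedHarmonic_add_one (by simp) hu, shiftedHarmonic_add_one (by simp) hu]
    have : 0 < u + 1 := by positivity
    field_simp
    ring
  · have hz : 0 ≤ zetaValue 2 := (hasSum_zetaValue le_rfl).nonneg fun n => by positivity
    have h : ∀ n : ℕ, harmonicPowerSum 2 ((n : ℝ) + 1 + 1) - harmonicPowerSum 2 ((n : ℝ) + 1) =
        (harmonicOfOrder 1 n ^ 2 + harmonicOfOrder 2 n + zetaValue 2 +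
          harmonicOfOrder 1 (n + 1) / ((n : ℝ) + 1)) * (1 / ((n : ℝ) + 1)) := fun n => by
      rw [hinc n n.cast_nonneg, ← shiftedHarmonic_natCast (by simp),
        ← shiftedHarmonic_natCast (by simp), ← shiftedHarmonic_natCast (by simp)]
      push_cast
      ring
    have hone : Tendsto (fun n : ℕ => 1 / ((n : ℝ) + 1)) atTop (𝓝 0) :=
      tendsto_one_div_add_atTop_nhds_zero_nat
    have t2 := tendsto_harmonicOfOrder_one_pow_div (j := 2) (by simp) one_pos
    have t1 := tendsto_harmonicOfOrder_one_pow_div (j := 1) (by simp) one_pos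
    have hlim := ((t2.add t1).add (hone.const_mul (zetaValue 2))).add (t1.add hone)
    simp only [mul_zero, add_zero] at hlim
    simp only [h]
    refine squeeze_zero (fun n => ?_) (fun n => ?_) hlim
    · have h1 := harmonicOfOrder_nonneg 1 n
      have h2 := harmonicOfOrder_nonneg 2 n
      have h3 := harmonicOfOrder_nonneg 1 (n + 1)
      positivity
    · have h1 := harmonicOfOrder_nonneg 1 n
      have h2 := harmonicOfOrder_two_le n
      have hn : 1 ≤ (n : ℝ) + 1 := by linarith [n.cast_nonneg (α := ℝ)]
      have h3 : harmonicOfOrder 1 (n + 1) / ((n : ℝ) + 1) ≤ harmonicOfOrder 1 n + 1 := by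
        rw [harmonicOfOrder_succ]
        refine (div_le_self (by positivity) hn).trans ?_
        gcongr
        rw [pow_one]
        exact (div_le_one₀ (by positivity)).2 hn
      have h4 : (0 : ℝ) ≤ 1 / ((n : ℝ) + 1) := by positivity
      calc _ ≤ (harmonicOfOrder 1 n ^ 2 + harmonicOfOrder 1 n + zetaValue 2 +
            (harmonicOfOrder 1 n + 1)) * (1 / ((n : ℝ) + 1)) := by gcongr
        _ = _ := by ring
  · simp [shiftedHarmonic_zero, harmonicPowerSum_two_one]
    ring

/-! ### Series with a unit gap -/

theorem tendsto_harmonicOfOrder {m : ℕ} (hm : 2 ≤ m) :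
    Tendsto (harmonicOfOrder m) atTop (𝓝 (zetaValue m)) := by
  refine (hasSum_zetaValue hm).tendsto_sum_nat.congr fun n => ?_
  induction n with
  | zero => simp [harmonicOfOrder_zero]
  | succ n ih => rw [Finset.sum_range_succ, ih, harmonicOfOrder_succ]

theorem hasSum_harmonicOfOrder_two_mul {a : ℝ} (ha : 0 < a) :
    HasSum (fun n : ℕ => harmonicOfOrder 2 (n + 1) *
      (1 / ((n : ℝ) + 1) - 1 / ((n : ℝ) + 1 + a)))
      (linearSum a - (zetaValue 2 - shiftedHarmonic 1 a / a) / a - linearSum 0 + zetaValue 3) := by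
  -- This is the tail of the series Σ (1/n - 1/(n+a)): it decreases to 0 and its successive
  -- differences are the weights.
  set t : ℕ → ℝ := fun n => shiftedHarmonic 1 ((n : ℝ) + a) - harmonicOfOrder 1 n with ht
  have hsucc : ∀ n : ℕ, shiftedHarmonic 1 ((n : ℝ) + 1 + a) =
      shiftedHarmonic 1 ((n : ℝ) + a) + 1 / ((n : ℝ) + 1 + a) := fun n => by
    rw [add_right_comm, shiftedHarmonic_add_one (by simp) (by positivity), pow_one]
  have htsub : ∀ n : ℕ, t n - t (n + 1) = 1 / ((n : ℝ) + 1) - 1 / ((n : ℝ) + 1 + a) := fun n => by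
    simp only [ht]
    push_cast
    rw [hsucc, harmonicOfOrder_succ, pow_one]
    ring
  have hanti : Antitone t := antitone_nat_of_succ_le fun n => by
    have h := one_div_sub_one_div_eq (by positivity : 0 < (n : ℝ) + 1) ha.le
    have h2 : 0 ≤ a * (1 / (((n : ℝ) + 1) * ((n : ℝ) + 1 + a))) := by positivity
    linarith [htsub n]
  have htlim : Tendsto t atTop (𝓝 0) := by
    have h := (hasSum_shiftedHarmonic_one ha.le).tendsto_sum_nat
    simp only [← htsub, Finset.sum_range_sub'] at h
    have h2 := h.const_sub (t 0)
    simpa [ht, harmonicOfOrder_zero] using h2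
  have h := hasSum_mul_sub_of_monotone (harmonicOfOrder_zero 2) (harmonicOfOrder_monotone 2) hanti
    (by simpa using (tendsto_harmonicOfOrder le_rfl).mul htlim)
    (((((hasSum_linearSum ha.le).sub (hasSum_one_div_sq_mul ha)).sub
      hasSum_harmonic_div_sq).add (hasSum_zetaValue (m := 3) (by norm_num))).congr_fun fun n => by
        rw [hsucc, harmonicOfOrder_succ, harmonicOfOrder_succ]
        have : 0 < (n : ℝ) + 1 + a := by positivity
        simp only [ht]
        field_simp
        ring)
  simpa only [htsub] using h

theorem hasSum_harmonic_mul_harmonic_two {a : ℝ} (ha : 0 < a) :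
    HasSum (fun n : ℕ => harmonicOfOrder 1 (n + 1) * harmonicOfOrder 2 (n + 1) *
      (1 / ((n : ℝ) + 1 + a) - 1 / ((n : ℝ) + 1 + (a + 1))))
      (1 / a * linearSum a - (shiftedHarmonic 1 a ^ 2 + shiftedHarmonic 2 a) / (2 * a ^ 2) -
        zetaValue 2 * (1 / a ^ 2) + shiftedHarmonic 1 a / a ^ 3) := by
  have hmono : Monotone fun n => harmonicOfOrder 1 n * harmonicOfOrder 2 n := fun m n hmn =>
    mul_le_mul (harmonicOfOrder_monotone 1 hmn) (harmonicOfOrder_monotone 2 hmn)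
      (harmonicOfOrder_nonneg _ _) (harmonicOfOrder_nonneg _ _)
  have hlim : Tendsto (fun n : ℕ => harmonicOfOrder 1 n * harmonicOfOrder 2 n *
      (1 / ((n : ℝ) + (1 + a)))) atTop (𝓝 0) := by
    refine squeeze_zero (fun n => ?_) (fun n => ?_)
      (tendsto_harmonicOfOrder_one_pow_div (j := 2) (c := 1 + a) (by simp) (by positivity))
    · have h1 := harmonicOfOrder_nonneg 1 n
      have h2 := harmonicOfOrder_nonneg 2 n
      positivity
    · have h1 := harmonicOfOrder_nonneg 1 n
      have h2 := harmonicOfOrder_two_le n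
      rw [sq]
      gcongr
  -- The increment of H_n H_n^(2) is H_n/n^2 + H_n^(2)/n - 1/n^3; each term over n+a is split by
  -- partial fractions.
  have hs := ((((hasSum_harmonic_div_sq.sub ((hasSum_harmonicPowerSum (j := 1) (by simp)
    ha.le).div_const a)).add (hasSum_harmonicOfOrder_two_mul ha)).sub
      (hasSum_zetaValue (m := 3) (by norm_num))).add (hasSum_one_div_sq_mul ha)).div_const a
  have h := hasSum_mul_sub_of_monotone (by simp [harmonicOfOrder_zero]) hmono
    (antitone_one_div_nat_add (by positivity : 0 < 1 + a)) hlim (hs.congr_fun fun n => by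
      rw [← add_assoc, harmonicOfOrder_succ, harmonicOfOrder_succ]
      have : 0 < (n : ℝ) + 1 + a := by positivity
      field_simp
      ring)
  convert h.congr_fun (g := fun n : ℕ => harmonicOfOrder 1 (n + 1) * harmonicOfOrder 2 (n + 1) *
      (1 / ((n : ℝ) + 1 + a) - 1 / ((n : ℝ) + 1 + (a + 1)))) (fun n => ?_) using 1
  · rw [harmonicPowerSum_one_eq_sub ha]
    field_simp
    ring
  · push_cast
    ring_nf

theorem hasSum_harmonic_cube {a : ℝ} (ha : 0 < a) :
    HasSum (fun n : ℕ => harmonicOfOrder 1 (n + 1) ^ 3 *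
      (1 / ((n : ℝ) + 1 + a) - 1 / ((n : ℝ) + 1 + (a + 1))))
      ((shiftedHarmonic 1 a ^ 3 + 3 * shiftedHarmonic 1 a * shiftedHarmonic 2 a +
          2 * shiftedHarmonic 3 a) / a + 3 * (1 / a * linearSum a) -
        3 / 2 * ((shiftedHarmonic 1 a ^ 2 + shiftedHarmonic 2 a) / a ^ 2) -
        2 * zetaValue 3 * (1 / a) - zetaValue 2 * (1 / a ^ 2) + shiftedHarmonic 1 a / a ^ 3) := by
  -- The increment of H_n^3 is 3H_n^2/n - 3H_n/n^2 + 1/n^3. The two copies of 3 Σ H_n/n^2, one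
  -- inside the exponent-2 sum, cancel.
  have hs := (((((hasSum_harmonicPowerSum (j := 2) (by simp) ha.le).mul_left 3).sub
    ((hasSum_harmonic_div_sq.sub ((hasSum_harmonicPowerSum (j := 1) (by simp)
      ha.le).div_const a)).mul_left 3)).add (hasSum_zetaValue (m := 3) (by norm_num))).sub
        (hasSum_one_div_sq_mul ha)).div_const a
  have h := hasSum_harmonicOfOrder_one_pow_by_parts (j := 3) (by simp)
    (by positivity : 0 < 1 + a) (hs.congr_fun fun n => by
      rw [← add_assoc, harmonicOfOrder_succ]
      have : 0 < (n : ℝ) + 1 + a := by positivity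
      field_simp
      ring)
  convert h.congr_fun (g := fun n : ℕ => harmonicOfOrder 1 (n + 1) ^ 3 *
      (1 / ((n : ℝ) + 1 + a) - 1 / ((n : ℝ) + 1 + (a + 1)))) (fun n => ?_) using 1
  · have h2 : harmonicPowerSum 2 a = harmonicPowerSum 2 (a + 1) -
        (2 * harmonicPowerSum 1 a - zetaValue 2 + shiftedHarmonic 1 a / a) / a := by
      rw [harmonicPowerSum_two_add_one ha]
      ring
    rw [h2, harmonicPowerSum_two_eq ha.le, harmonicPowerSum_one_eq_sub ha]
    field_simp
    ring
  · ring_nf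

/-! ### General gaps and assembly -/

/-- Partial fractions reduce a denominator `(n+a)(n+a+k)` to the unit gaps `k = 1`. -/
theorem hasSum_pnat_div_mul_of_unit_gaps {k : ℕ} (hk : 1 ≤ k) {a : ℝ} (ha : 0 < a) {X : ℕ → ℝ}
    {s : ℝ → ℝ} (hs : ∀ b, 0 < b → HasSum (fun n : ℕ => X (n + 1) *
      (1 / ((n : ℝ) + 1 + b) - 1 / ((n : ℝ) + 1 + (b + 1)))) (s b)) :
    HasSum (fun n : ℕ+ => X n / (((n : ℝ) + a) * ((n : ℝ) + a + k)))
      (1 / (k : ℝ) * ∑ i ∈ Finset.range k, s (a + i)) := by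
  have h := (hasSum_sum (s := Finset.range k) fun i _ =>
    hs (a + i) (by positivity)).mul_left (1 / (k : ℝ))
  rw [← Equiv.pnatEquivNat.symm.hasSum_iff]
  refine h.congr_fun fun n => ?_
  have htel : ∑ i ∈ Finset.range k, (1 / ((n : ℝ) + 1 + (a + i)) -
      1 / ((n : ℝ) + 1 + (a + i + 1))) = 1 / ((n : ℝ) + 1 + a) - 1 / ((n : ℝ) + 1 + (a + k)) := by
    have := Finset.sum_range_sub' (fun i : ℕ => 1 / ((n : ℝ) + 1 + (a + i))) k
    simpa [add_assoc] using this
  rw [← Finset.mul_sum, htel]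
  have hk0 : (0 : ℝ) < k := by exact_mod_cast hk
  have : 0 < (n : ℝ) + 1 + a := by positivity
  have : 0 < (n : ℝ) + 1 + (a + k) := by positivity
  simp only [Function.comp_apply, Equiv.pnatEquivNat_symm_apply, Nat.succPNat_coe,
    Nat.succ_eq_add_one, Nat.cast_add, Nat.cast_one]
  rw [add_assoc ((n : ℝ) + 1) a]
  field_simp
  ring

theorem shiftedHarmonic_one_add_natCast {a : ℝ} (ha : 0 ≤ a) (i : ℕ) :
    shiftedHarmonic 1 (a + i) = shiftedHarmonic 1 a + parametricHarmonic 1 i a := by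
  induction i with
  | zero => simp [parametricHarmonic]
  | succ i ih =>
    rw [parametricHarmonic, Finset.sum_Icc_succ_top (by omega), ← parametricHarmonic]
    push_cast
    rw [← add_assoc a, shiftedHarmonic_add_one (by simp) (by positivity), ih]
    ring

theorem sum_Icc_one_eq_sum_range (k : ℕ) (f : ℕ → ℝ) :
    ∑ i ∈ Finset.Icc 1 k, f i = ∑ i ∈ Finset.range k, f (i + 1) := by
  induction k with
  | zero => simp
  | succ k ih => rw [Finset.sum_Icc_succ_top (by omega), ih, Finset.sum_range_succ]

theorem sum_Icc_one_sub_one {k : ℕ} (hk : 1 ≤ k) (f : ℕ → ℝ) :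
    ∑ i ∈ Finset.Icc 1 (k - 1), f i = ∑ i ∈ Finset.range k, f i - f 0 := by
  obtain ⟨m, rfl⟩ : ∃ m, k = m + 1 := ⟨k - 1, by omega⟩
  rw [Finset.sum_range_succ', Nat.add_sub_cancel, sum_Icc_one_eq_sum_range, add_sub_cancel_right]

theorem theorem2p6 (k : ℕ) (hk : 1 ≤ k) (a : ℝ) (ha : 0 < a) :
    (∀ i ∈ Finset.range k,
      Summable (fun n : ℕ+ => shiftedHarmonic 1 ((n : ℝ) + (a + i)) / (n : ℝ) ^ 2)) ∧
    HasSum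
      (fun n : ℕ+ =>
        harmonicOfOrder 1 n * harmonicOfOrder 2 n / (((n : ℝ) + a) * ((n : ℝ) + a + k)))
      (1 / (k : ℝ) *
        (∑ i ∈ Finset.range k, 1 / (a + i) * linearSum (a + i)
          - ∑ i ∈ Finset.range k,
              (shiftedHarmonic 1 (a + i) ^ 2 + shiftedHarmonic 2 (a + i)) / (2 * (a + i) ^ 2)
          - zetaValue 2 * parametricHarmonic 2 k (a - 1)
          + ∑ i ∈ Finset.range k, shiftedHarmonic 1 (a + i) / (a + i) ^ 3)) ∧
    HasSum
      (fun n : ℕ+ => harmonicOfOrder 1 n ^ 3 / (((n : ℝ) + a) * ((n : ℝ) + a + k)))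
      (1 / (k : ℝ) *
        (∑ i ∈ Finset.Icc 1 k,
            (shiftedHarmonic 1 (a + i - 1) ^ 3
              + 3 * shiftedHarmonic 1 (a + i - 1) * shiftedHarmonic 2 (a + i - 1)
              + 2 * shiftedHarmonic 3 (a + i - 1)) / (a + i - 1)
          + 3 * ∑ i ∈ Finset.range k, 1 / (a + i) * linearSum (a + i)
          + 3 * ∑ i ∈ Finset.Icc 1 (k - 1), shiftedHarmonic 1 (a + i) / (a + i) ^ 3
          - 3 / 2 * ∑ i ∈ Finset.range k,
              (shiftedHarmonic 1 (a + i) ^ 2 + shiftedHarmonic 2 (a + i)) / (a + i) ^ 2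
          - zetaValue 2 * parametricHarmonic 2 (k - 1) a
          - 2 * ∑ i ∈ Finset.Icc 1 (k - 1), parametricHarmonic 1 i a / ((i : ℝ) + a) ^ 3
          - 2 * zetaValue 3 * parametricHarmonic 1 (k - 1) a
          - 2 * shiftedHarmonic 1 a * parametricHarmonic 3 (k - 1) a
          - 2 * (zetaValue 3 / a) - zetaValue 2 / a ^ 2 + shiftedHarmonic 1 a / a ^ 3)) := by
  refine ⟨fun i _ => ?_, ?_, ?_⟩
  · rw [← Equiv.pnatEquivNat.symm.summable_iff]
    refine (hasSum_linearSum (by positivity : 0 ≤ a + i)).summable.congr fun n => ?_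
    simp [Equiv.pnatEquivNat]
  · convert hasSum_pnat_div_mul_of_unit_gaps hk ha
      (X := fun n => harmonicOfOrder 1 n * harmonicOfOrder 2 n)
      (fun b hb => hasSum_harmonic_mul_harmonic_two hb) using 2
    rw [Finset.sum_add_distrib, Finset.sum_sub_distrib, Finset.sum_sub_distrib, ← Finset.mul_sum,
      parametricHarmonic, sum_Icc_one_eq_sum_range]
    have : ∀ i : ℕ, ((i + 1 : ℕ) : ℝ) + (a - 1) = a + i := fun i => by push_cast; ring
    simp only [this]
  · convert hasSum_pnat_div_mul_of_unit_gaps hk ha (X := fun n => harmonicOfOrder 1 n ^ 3)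
      (fun b hb => hasSum_harmonic_cube hb) using 2
    have hshift : ∀ i : ℕ, a + ((i + 1 : ℕ) : ℝ) - 1 = a + i := fun i => by push_cast; ring
    -- By H_i(a) = H_{a+i} - H_a, the terms with cubed denominators collapse to one copy of Σ
    -- H_{a+i}/(a+i)^3 over i ≥ 1, and the separate H_a/a^3 supplies i = 0.
    have hcube : ∑ i ∈ Finset.Icc 1 (k - 1), parametricHarmonic 1 i a / ((i : ℝ) + a) ^ 3 =
        ∑ i ∈ Finset.Icc 1 (k - 1), shiftedHarmonic 1 (a + i) / (a + i) ^ 3 -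
          shiftedHarmonic 1 a * parametricHarmonic 3 (k - 1) a := by
      rw [parametricHarmonic, Finset.mul_sum, ← Finset.sum_sub_distrib]
      refine Finset.sum_congr rfl fun i _ => ?_
      rw [shiftedHarmonic_one_add_natCast ha.le, add_comm a (i : ℝ)]
      ring
    have hpar : ∀ m : ℕ, parametricHarmonic m (k - 1) a =
        ∑ i ∈ Finset.range k, 1 / (a + i) ^ m - 1 / a ^ m := by
      intro m
      rw [parametricHarmonic, sum_Icc_one_sub_one hk (fun i => 1 / ((i : ℝ) + a) ^ m)]
      simp [add_comm]
    rw [hcube, sum_Icc_one_sub_one hk (fun i => shiftedHarmonic 1 (a + i) / (a + i) ^ 3),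
      hpar 1, hpar 2, sum_Icc_one_eq_sum_range k]
    simp only [hshift, pow_one, Nat.cast_zero, add_zero, Finset.sum_add_distrib,
      Finset.sum_sub_distrib, ← Finset.mul_sum]
    ring
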